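/- Let $\mathcal T$ be a finite-dimensional real inner product space, $n\ge 0$, and let $h:\mathcal T\to(-\infty,+\infty]$ be a convex function such that (i) its effective domain $\mathrm{dom}(h)=\{y: h(y)<+\infty\}$ is non-empty and open and $h$ is continuously differentiable on $\mathrm{dom}(h)$; (ii) for every compact convex set $V\subseteq\mathrm{dom}(h)$, $h$ is strongly convex on $V$ and $\nabla h$ is Lipschitz continuous on $V$. Let $\mathcal A:\mathbb R^n\to\mathcal T$ be linear, $c\in\mathbb R^n$, and $f(x)=h(\mathcal A(x))+\langle c,x\rangle$. Let $\mathcal J$ be a partition of $\{1,\dots,n\}$, let $\omega_J\ge 0$ for $J\in\mathcal J$, and let $P(x)=\sum_{J\in\mathcal J}\omega_J\|x_J\|_2$ be the grouped LASSO regularizer, where $x_J\in\mathbb R^{|J|}$ is the restriction of $x$ to the entries in $J$. Put $F=f+P$, $v^*=\inf_{x\in\mathbb R^n}F(x)$, and let $\mathcal X=\{x\in\mathbb R^n : F(x)=v^*<+\infty\}$ be the set of optimal solutions; assume that $\mathcal X$ is non-empty and compact. Define $$\mathrm{prox}_P(x)=\operatorname*{argmin}_{z\in\mathbb R^n}\Big\{\tfrac12\|x-z\|_2^2+P(z)\Big\},\qquad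 R(x)=\mathrm{prox}_P(x-\nabla f(x))-x .$$ Then for every real $\zeta\ge v^*$ there exist constants $\kappa>0$ and $\epsilon>0$ such that $$d(x,\mathcal X)\le\kappa\,\|R(x)\|_2\quad\text{for all }x\in\mathbb R^n\text{ with }F(x)\le\zeta\text{ and }\|R(x)\|_2\le\epsilon ,$$ where $d(x,\mathcal X)=\inf_{z\in\mathcal X}\|x-z\|_2$. -/

import Mathlib

open scoped Gradient

noncomputable section

namespace GroupLassoEB

/-- Effective domain of an extended-real-valued function. -/
def effDom {X : Type*} (h : X → EReal) : Set X := {y | h y < ⊤}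

/-- Real-valued version of `h`; it is meaningful on the effective domain. -/
def realPart {X : Type*} (h : X → EReal) : X → ℝ := fun y => (h y).toReal

/-- Convexity of an extended-real-valued function: its epigraph is a convex set. -/
def ConvexEReal {X : Type*} [AddCommGroup X] [Module ℝ X] (h : X → EReal) : Prop :=
  Convex ℝ {p : X × ℝ | h p.1 ≤ (p.2 : EReal)}

/-- The structural hypotheses on the outer function `h : T → (-∞, +∞]` of the loss
`f x = h (A x) + ⟪c, x⟫`. -/
structure IsAdmissible {T : Type*} [NormedAddCommGroup T] [InnerProductSpace ℝ T]
    [FiniteDimensional ℝ T] (h : T → EReal) : Prop where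
  ne_bot : ∀ y, h y ≠ ⊥
  convex : ConvexEReal h
  dom_nonempty : (effDom h).Nonempty
  dom_open : IsOpen (effDom h)
  contDiffOn : ContDiffOn ℝ 1 (realPart h) (effDom h)
  strongConvexOn : ∀ V : Set T, IsCompact V → Convex ℝ V → V ⊆ effDom h →
    ∃ σ : ℝ, 0 < σ ∧ StrongConvexOn V σ (realPart h)
  lipschitzOn_gradient : ∀ V : Set T, IsCompact V → Convex ℝ V → V ⊆ effDom h →
    ∃ L : NNReal, LipschitzOnWith L (∇ (realPart h)) V

section Problem

variable {E T : Type*} [NormedAddCommGroup E] [InnerProductSpace ℝ E] [FiniteDimensional ℝ E]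
  [NormedAddCommGroup T] [InnerProductSpace ℝ T] [FiniteDimensional ℝ T]

/-- The loss function `f x = h (A x) + ⟪c, x⟫`. -/
def loss (h : T → EReal) (A : E →ₗ[ℝ] T) (c : E) : E → EReal :=
  fun x => h (A x) + ((inner ℝ c x : ℝ) : EReal)

/-- The objective function `F = f + P` with a finite-valued regularizer `P`. -/
def objective (f : E → EReal) (P : E → ℝ) : E → EReal :=
  fun x => f x + ((P x : ℝ) : EReal)

/-- The set of (feasible) global minimizers of `F`. -/
def optimalSet (F : E → EReal) : Set E := {x | F x < ⊤ ∧ ∀ z, F x ≤ F z}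

/-- `p` minimizes `z ↦ ½‖x - z‖² + P z`. -/
def IsProx (P : E → ℝ) (x p : E) : Prop :=
  ∀ z, 1 / 2 * ‖x - p‖ ^ 2 + P p ≤ 1 / 2 * ‖x - z‖ ^ 2 + P z

/-- The proximal map of `P` (the minimizer exists and is unique for the regularizers used here,
see `existsUnique_isProx`). -/
def prox (P : E → ℝ) (x : E) : E := Classical.epsilon (IsProx P x)

/-- The residual map `R x = prox_P (x - ∇f x) - x`. -/
def residual (f : E → EReal) (P : E → ℝ) (x : E) : E :=
  prox P (x - ∇ (realPart f) x) - x

/-- The Lipschitzian error bound with proximal-map-based residual. The quantity `⨅ x, F x` is the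
optimal value. -/
def ProxErrorBound (f : E → EReal) (P : E → ℝ) : Prop :=
  ∀ ζ : ℝ, (⨅ x, objective f P x) ≤ (ζ : EReal) →
    ∃ κ : ℝ, 0 < κ ∧ ∃ ε : ℝ, 0 < ε ∧
      ∀ x : E, objective f P x ≤ (ζ : EReal) → ‖residual f P x‖ ≤ ε →
        Metric.infDist x (optimalSet (objective f P)) ≤ κ * ‖residual f P x‖

end Problem

/-- The restriction `x_J` of `x` to the coordinates in `J`, with the Euclidean norm. -/
def restrictTo {n : ℕ} (J : Finset (Fin n)) (x : EuclideanSpace ℝ (Fin n)) :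
    EuclideanSpace ℝ J :=
  WithLp.toLp 2 (fun i : J => x i)

/-- The grouped LASSO regularizer `P x = ∑ J, ω_J ‖x_J‖₂`, summed over the groups of a partition
of the index set. -/
def groupLasso {n : ℕ} (𝒥 : Finpartition (Finset.univ : Finset (Fin n)))
    (ω : Finset (Fin n) → ℝ) (x : EuclideanSpace ℝ (Fin n)) : ℝ :=
  ∑ J ∈ 𝒥.parts, ω J * ‖restrictTo J x‖

theorem continuous_groupLasso {n : ℕ} (𝒥 : Finpartition (Finset.univ : Finset (Fin n)))
    (ω : Finset (Fin n) → ℝ) : Continuous (groupLasso 𝒥 ω) := by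
  unfold groupLasso restrictTo
  fun_prop

theorem convexOn_groupLasso {n : ℕ} (𝒥 : Finpartition (Finset.univ : Finset (Fin n)))
    (ω : Finset (Fin n) → ℝ) (hω : ∀ J ∈ 𝒥.parts, 0 ≤ ω J) :
    ConvexOn ℝ Set.univ (groupLasso 𝒥 ω) := by
  refine ⟨convex_univ, fun x _ y _ a b ha hb _ => ?_⟩
  simp only [groupLasso, smul_eq_mul, Finset.mul_sum, ← Finset.sum_add_distrib]
  refine Finset.sum_le_sum fun J hJ => ?_
  have h1 : restrictTo J (a • x + b • y) = a • restrictTo J x + b • restrictTo J y := by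
    ext i; simp [restrictTo]
  have h2 := norm_add_le (a • restrictTo J x) (b • restrictTo J y)
  rw [norm_smul, norm_smul, Real.norm_of_nonneg ha, Real.norm_of_nonneg hb] at h2
  rw [h1]
  nlinarith [mul_le_mul_of_nonneg_left h2 (hω J hJ)]

/-- The proximal map of the grouped LASSO regularizer is well defined. -/
theorem existsUnique_isProx {n : ℕ} (𝒥 : Finpartition (Finset.univ : Finset (Fin n)))
    (ω : Finset (Fin n) → ℝ) (hω : ∀ J ∈ 𝒥.parts, 0 ≤ ω J) (x : EuclideanSpace ℝ (Fin n)) :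
    ∃! p, IsProx (groupLasso 𝒥 ω) x p := by
  set g : EuclideanSpace ℝ (Fin n) → ℝ :=
    fun z => 1 / 2 * ‖x - z‖ ^ 2 + groupLasso 𝒥 ω z with hg
  have hcont : Continuous g := by
    have := continuous_groupLasso 𝒥 ω
    fun_prop
  have hnonneg : ∀ z, 0 ≤ groupLasso 𝒥 ω z := fun z =>
    Finset.sum_nonneg fun J hJ => mul_nonneg (hω J hJ) (norm_nonneg _)
  have hstrong : StrongConvexOn Set.univ 1 g := by
    rw [strongConvexOn_iff_convex]
    have hP := convexOn_groupLasso 𝒥 ω hω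
    refine ⟨convex_univ, fun y _ z _ a b ha hb hab => ?_⟩
    have h1 := hP.2 (Set.mem_univ y) (Set.mem_univ z) ha hb hab
    have h2 : ∀ w, g w - 1 / 2 * ‖w‖ ^ 2 = 1 / 2 * ‖x‖ ^ 2 - inner ℝ x w + groupLasso 𝒥 ω w := by
      intro w
      simp only [hg, norm_sub_sq_real]
      ring
    simp only [h2, inner_add_right, inner_smul_right, smul_eq_mul] at h1 ⊢
    have h3 : b = 1 - a := by linarith
    subst h3
    linarith
  obtain ⟨p, hp⟩ : ∃ p, ∀ z, g p ≤ g z := by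
    have hK : IsCompact (Metric.closedBall x (2 * g x + 1)) := isCompact_closedBall _ _
    have hgx : 0 ≤ g x := by simpa [hg] using hnonneg x
    obtain ⟨p, -, hpm⟩ := hK.exists_isMinOn ⟨x, by simp; linarith⟩ hcont.continuousOn
    refine ⟨p, fun z => ?_⟩
    by_cases hz : z ∈ Metric.closedBall x (2 * g x + 1)
    · exact hpm hz
    · have h1 : g p ≤ g x := hpm (by simp; linarith)
      rw [Metric.mem_closedBall, dist_comm, dist_eq_norm, not_le] at hz
      have h2 := hnonneg z
      have h3 : g z = 1 / 2 * ‖x - z‖ ^ 2 + groupLasso 𝒥 ω z := rfl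
      nlinarith
  refine ⟨p, hp, fun q hq => ?_⟩
  exact (hstrong.strictConvexOn one_pos).eq_of_isMinOn (fun z _ => hq z) (fun z _ => hp z)
    (Set.mem_univ _) (Set.mem_univ _)

end GroupLassoEB

end

/-! With g = ∇f(x) and R = R(x), the prox condition reads -g - R ∈ ∂P(x + R), a perturbation of the
optimality condition -g ∈ ∂P(x). The error bound rests on three facts.

Localization (`exists_infDist_le_of_residual_le`): compactness of 𝒳 and convexity make F grow at
least linearly away from 𝒳, while F(x) - v* ≤ ‖R‖ (const + dist). So a small residual forces x close
to 𝒳, and the strong convexity and Lipschitz constants of h can be taken on one compact convex set.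

Calmness (`exists_upperLipschitz_groupLasso`): for fixed s, the points with s ∈ ∂P(x) form a
polyhedron, since each block of x is free, on the ray of s_J, or zero. Hoffman's bound then controls
the distance from x + R to a point w with A w = A x₀ and -∇f(x₀) ∈ ∂P(w), where x₀ is a fixed
optimum. Such a w has the same gradient as x₀, so it is optimal.

Monotonicity (`exists_infDist_le_mul_norm_residual`): calmness bounds ‖x + R - w‖ by a multiple of
‖A x - A w‖ + ‖R‖. Strong monotonicity of ∇h against monotonicity of ∂P gives ‖A x - A w‖² ≲ ‖R‖ (‖A
x - A w‖ + ‖R‖), hence ‖A x - A w‖ ≲ ‖R‖. -/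

noncomputable section

namespace GroupLassoEB

open Filter Topology

/-! ### Subgradients of finite convex functions and the prox condition. -/

section Subgradient

variable {E : Type*} [NormedAddCommGroup E] [InnerProductSpace ℝ E]

/-- `s` is a subgradient of the finite function `P` at `x`. -/
def IsSubgradient (P : E → ℝ) (s x : E) : Prop := ∀ z, P x + inner ℝ s (z - x) ≤ P z

theorem IsSubgradient.inner_sub_nonneg {P : E → ℝ} {s s' x x' : E} (h : IsSubgradient P s x)
    (h' : IsSubgradient P s' x') : 0 ≤ inner ℝ (s - s') (x - x') := by
  have h1 := h x'
  have h2 := h' x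
  rw [← neg_sub x x', inner_neg_right] at h1
  rw [inner_sub_left]
  linarith

theorem IsSubgradient.norm_le {P : E → ℝ} {M : ℝ} (hM : ∀ x y, P x - P y ≤ M * ‖x - y‖) {s x : E}
    (h : IsSubgradient P s x) (hM0 : 0 ≤ M) : ‖s‖ ≤ M := by
  have h1 := h (x + s)
  have h2 := hM (x + s) x
  simp only [add_sub_cancel_left, real_inner_self_eq_norm_sq] at h1 h2
  by_contra! h3
  nlinarith [norm_nonneg s]

/-- Divide by τ and let τ decrease to 0. This converts convexity inequalities along a segment into
first-order ones. -/
theorem hasDerivAt_le_of_le_quadratic {φ : ℝ → ℝ} {φ' a b : ℝ} (hφ : HasDerivAt φ φ' 0)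
    (hle : ∀ τ, 0 < τ → τ < 1 → φ τ ≤ φ 0 + τ * a + τ ^ 2 * b) : φ' ≤ a := by
  have h1 := hφ.tendsto_slope_zero_right
  have h2 : Tendsto (fun τ : ℝ => a + τ * b) (𝓝[>] 0) (𝓝 a) := by
    have : Continuous fun τ : ℝ => a + τ * b := by fun_prop
    simpa using (this.tendsto 0).mono_left nhdsWithin_le_nhds
  refine le_of_tendsto_of_tendsto h1 h2 ?_
  filter_upwards [Ioo_mem_nhdsGT (zero_lt_one' ℝ)] with τ hτ
  have h3 := hle τ hτ.1 hτ.2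
  simp only [zero_add, smul_eq_mul]
  rw [inv_mul_le_iff₀ hτ.1]
  nlinarith

theorem IsProx.isSubgradient {P : E → ℝ} (hP : ConvexOn ℝ Set.univ P) {x p : E}
    (h : IsProx P x p) : IsSubgradient P (x - p) p := by
  intro z
  have h1 : HasDerivAt (fun τ : ℝ => τ * inner ℝ (x - p) (z - p)) (inner ℝ (x - p) (z - p)) 0 := by
    simpa using (hasDerivAt_id (0 : ℝ)).mul_const (inner ℝ (x - p) (z - p))
  have h2 := hasDerivAt_le_of_le_quadratic h1 (a := P z - P p) (b := 1 / 2 * ‖z - p‖ ^ 2) ?_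
  · linarith
  intro τ h0 h1
  have h3 := hP.2 (Set.mem_univ p) (Set.mem_univ z) (by linarith : 0 ≤ 1 - τ) h0.le (by ring)
  have h4 := h ((1 - τ) • p + τ • z)
  have h5 : x - ((1 - τ) • p + τ • z) = (x - p) - τ • (z - p) := by module
  rw [h5, norm_sub_sq_real (x - p) (τ • (z - p)), inner_smul_right, norm_smul,
    Real.norm_of_nonneg h0.le] at h4
  simp only [smul_eq_mul] at h3
  simp only [zero_mul, zero_add]
  nlinarith

end Subgradient

/-! ### First-order inequalities and Fermat's rule. -/

section Analysis

variable {E T : Type*} [NormedAddCommGroup E] [InnerProductSpace ℝ E] [CompleteSpace E]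

theorem _root_.HasGradientAt.hasDerivAt_line {φ : E → ℝ} {g x : E} (h : HasGradientAt φ g x)
    (d : E) : HasDerivAt (fun τ : ℝ => φ (x + τ • d)) (inner ℝ g d) 0 := by
  have := h.hasFDerivAt.hasLineDerivAt d
  simpa [HasLineDerivAt] using this

/-- First-order inequality for a function that is strongly convex (convex if `m = 0`) on a set. -/
theorem inner_gradient_le_of_strongConvexOn {s : Set E} {φ : E → ℝ} {m : ℝ}
    (hφ : StrongConvexOn s m φ) {g x y : E} (hg : HasGradientAt φ g x) (hx : x ∈ s) (hy : y ∈ s) :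
    φ x + inner ℝ g (y - x) + m / 2 * ‖y - x‖ ^ 2 ≤ φ y := by
  have h1 := hasDerivAt_le_of_le_quadratic (hg.hasDerivAt_line (y - x))
    (a := φ y - φ x - m / 2 * ‖y - x‖ ^ 2) (b := m / 2 * ‖y - x‖ ^ 2) ?_
  · linarith
  intro τ h0 h1
  have h2 := hφ.2 hx hy (by linarith : 0 ≤ 1 - τ) h0.le (by ring)
  have h3 : (1 - τ) • x + τ • y = x + τ • (y - x) := by module
  rw [h3, norm_sub_rev x y] at h2
  simp only [smul_eq_mul] at h2
  simp only [zero_smul, add_zero]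
  nlinarith

theorem inner_gradient_le_of_convexOn {s : Set E} {φ : E → ℝ} (hφ : ConvexOn ℝ s φ) {g x y : E}
    (hg : HasGradientAt φ g x) (hx : x ∈ s) (hy : y ∈ s) : φ x + inner ℝ g (y - x) ≤ φ y := by
  simpa using inner_gradient_le_of_strongConvexOn (strongConvexOn_zero.2 hφ) hg hx hy

theorem inner_gradient_sub_ge_of_strongConvexOn {s : Set E} {φ : E → ℝ} {m : ℝ}
    (hφ : StrongConvexOn s m φ) {g g' x y : E} (hg : HasGradientAt φ g x)
    (hg' : HasGradientAt φ g' y) (hx : x ∈ s) (hy : y ∈ s) :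
    m * ‖x - y‖ ^ 2 ≤ inner ℝ (g - g') (x - y) := by
  have h1 := inner_gradient_le_of_strongConvexOn hφ hg hx hy
  have h2 := inner_gradient_le_of_strongConvexOn hφ hg' hy hx
  rw [norm_sub_rev y x, ← neg_sub x y, inner_neg_right] at h1
  rw [inner_sub_left]
  linarith

/-- Fermat's rule for a sum of a differentiable and a convex function. -/
theorem isSubgradient_neg_of_forall_le {P : E → ℝ} (hP : ConvexOn ℝ Set.univ P) {D : Set E}
    (hD : Convex ℝ D) (hDo : IsOpen D) {φ : E → ℝ} {g x : E} (hx : x ∈ D)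
    (hg : HasGradientAt φ g x)
    (hmin : ∀ z ∈ D, φ x + P x ≤ φ z + P z) : IsSubgradient P (-g) x := by
  intro z
  -- The point z may lie outside D. The argument is run at w = x + ρ(z - x) ∈ D, and convexity of P
  -- carries the inequality from w back to z.
  obtain ⟨ρ, hρ, hball⟩ : ∃ ρ : ℝ, 0 < ρ ∧ x + ρ • (z - x) ∈ D ∧ ρ ≤ 1 := by
    have hc : Continuous fun τ : ℝ => x + τ • (z - x) := by fun_prop
    have h1 : ∀ᶠ τ in 𝓝 (0 : ℝ), x + τ • (z - x) ∈ D :=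
      hc.continuousAt.eventually_mem (hDo.mem_nhds (by simpa using hx))
    have h2 : ∀ᶠ τ in 𝓝[>] (0 : ℝ), x + τ • (z - x) ∈ D := nhdsWithin_le_nhds h1
    obtain ⟨τ, h3, h4⟩ := (h2.and (Ioo_mem_nhdsGT (zero_lt_one' ℝ))).exists
    exact ⟨τ, h4.1, h3, h4.2.le⟩
  set w := x + ρ • (z - x) with hw
  have hwx : w - x = ρ • (z - x) := by simp [hw]
  have h1 := (hg.hasDerivAt_line (w - x)).neg
  have h2 := hasDerivAt_le_of_le_quadratic h1 (a := P w - P x) (b := 0) ?_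
  · have h3 := hP.2 (Set.mem_univ x) (Set.mem_univ z) (by linarith : 0 ≤ 1 - ρ) hρ.le (by ring)
    have h4 : (1 - ρ) • x + ρ • z = w := by rw [hw]; module
    rw [h4, smul_eq_mul, smul_eq_mul] at h3
    rw [hwx, inner_smul_right] at h2
    rw [inner_neg_left]
    have h5 : ρ * (P x + -inner ℝ g (z - x)) ≤ ρ * P z := by linarith
    exact le_of_mul_le_mul_left h5 hρ
  intro τ h0 h1
  have hy : x + τ • (w - x) = (1 - τ) • x + τ • w := by module
  have h3 := hP.2 (Set.mem_univ x) (Set.mem_univ w) (by linarith : 0 ≤ 1 - τ) h0.le (by ring)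
  have h4 := hmin _ (hD hx hball.1 (by linarith : 0 ≤ 1 - τ) h0.le (by ring))
  simp only [smul_eq_mul] at h3
  simp only [Pi.neg_apply, zero_smul, add_zero, hy]
  linarith

end Analysis

/-! ### Hoffman's error bound. -/

section Hoffman

/-- The coordinates of `z` have the signs prescribed by `σ`, in the weak sense. -/
def SignCompatible {ι : Type*} (σ : ι → SignType) (z : ι → ℝ) : Prop :=
  ∀ i, (σ i = 0 → z i = 0) ∧ (σ i = 1 → 0 ≤ z i) ∧ (σ i = -1 → z i ≤ 0)

theorem isClosed_signCompatible {ι : Type*} (σ : ι → SignType) :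
    IsClosed {z : ι → ℝ | SignCompatible σ z} := by
  simp only [SignCompatible, Set.ofPred_forall, Set.ofPred_and]
  refine isClosed_iInter fun i => ?_
  refine (isClosed_iInter fun _ => ?_).inter
    ((isClosed_iInter fun _ => ?_).inter (isClosed_iInter fun _ => ?_))
  · exact isClosed_eq (by fun_prop) (by fun_prop)
  · exact isClosed_le (by fun_prop) (by fun_prop)
  · exact isClosed_le (by fun_prop) (by fun_prop)

variable {ι W : Type*} [Fintype ι] [NormedAddCommGroup W] [NormedSpace ℝ W]

/-- The sign cone meets the unit sphere in a compact set, on which ‖M z‖ has a positive minimum if M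
has no nonzero kernel vector there; homogeneity does the rest. The kernel condition stands after κ
so that a constant can be chosen for every σ at once. -/
theorem exists_norm_le_of_signCompatible (M : (ι → ℝ) →ₗ[ℝ] W) (σ : ι → SignType) :
    ∃ κ : ℝ, 0 ≤ κ ∧ ((∀ z, SignCompatible σ z → M z = 0 → z = 0) →
      ∀ z, SignCompatible σ z → ‖z‖ ≤ κ * ‖M z‖) := by
  by_cases hker : ∀ z, SignCompatible σ z → M z = 0 → z = 0
  swap
  · exact ⟨0, le_rfl, fun h => absurd h hker⟩
  have hMc : Continuous M := M.continuous_of_finiteDimensional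
  have hK : IsCompact (Metric.sphere (0 : ι → ℝ) 1 ∩ {z | SignCompatible σ z}) :=
    (isCompact_sphere _ _).inter_right (isClosed_signCompatible σ)
  obtain ⟨c, hc, hcle⟩ : ∃ c : ℝ, 0 < c ∧ ∀ z ∈ Metric.sphere (0 : ι → ℝ) 1 ∩
      {z | SignCompatible σ z}, c ≤ ‖M z‖ := by
    rcases (Metric.sphere (0 : ι → ℝ) 1 ∩ {z | SignCompatible σ z}).eq_empty_or_nonempty with h | h
    · exact ⟨1, one_pos, by simp [h]⟩
    · obtain ⟨z₀, hz₀, hmin⟩ := hK.exists_isMinOn h hMc.norm.continuousOn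
      refine ⟨‖M z₀‖, norm_pos_iff.2 fun h0 => ?_, fun z hz => hmin hz⟩
      have := hker z₀ hz₀.2 h0
      have h1 := hz₀.1
      simp [this] at h1
  refine ⟨c⁻¹, by positivity, fun _ z hz => ?_⟩
  rcases eq_or_ne z 0 with rfl | hz0
  · simp
  have hpos : 0 < ‖z‖ := norm_pos_iff.2 hz0
  have hmem : ‖z‖⁻¹ • z ∈ Metric.sphere (0 : ι → ℝ) 1 ∩ {z | SignCompatible σ z} := by
    refine ⟨by simp [norm_smul, hpos.ne'], fun i => ?_⟩
    obtain ⟨h0, h1, h2⟩ := hz i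
    have hi : 0 ≤ ‖z‖⁻¹ := by positivity
    simp only [Pi.smul_apply, smul_eq_mul]
    exact ⟨fun h => by simp [h0 h], fun h => mul_nonneg hi (h1 h),
      fun h => mul_nonpos_of_nonneg_of_nonpos hi (h2 h)⟩
  have h1 := hcle _ hmem
  rw [map_smul, norm_smul, norm_inv, norm_norm, ← div_eq_inv_mul, le_div_iff₀ hpos] at h1
  rw [← div_eq_inv_mul, le_div_iff₀ hc]
  linarith

/-- Hoffman's error bound for a linear system in which some of the variables are constrained to be
nonnegative. -/
theorem exists_hoffman_bound (M : (ι → ℝ) →ₗ[ℝ] W) (S : Set ι) :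
    ∃ κ : ℝ, 0 ≤ κ ∧ ∀ t t₀ : ι → ℝ, (∀ i ∈ S, 0 ≤ t i) → (∀ i ∈ S, 0 ≤ t₀ i) →
      ∃ t', (∀ i ∈ S, 0 ≤ t' i) ∧ M t' = M t₀ ∧ ‖t' - t‖ ≤ κ * ‖M t - M t₀‖ := by
  classical
  choose κ hκ0 hκ using exists_norm_le_of_signCompatible M
  -- There are finitely many sign patterns, so the sum dominates the constant of whichever one
  -- occurs.
  refine ⟨∑ σ, κ σ, Finset.sum_nonneg fun σ _ => hκ0 σ, fun t t₀ ht ht₀ => ?_⟩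
  have hMc : Continuous M := M.continuous_of_finiteDimensional
  have hcl : IsClosed ({t' : ι → ℝ | ∀ i ∈ S, 0 ≤ t' i} ∩ {t' | M t' = M t₀}) := by
    refine IsClosed.inter ?_ (isClosed_eq hMc continuous_const)
    simp only [Set.ofPred_forall]
    exact isClosed_iInter fun i => isClosed_iInter fun _ =>
      isClosed_le (by fun_prop) (by fun_prop)
  -- the feasible point that is closest to `t` in the Euclidean norm
  obtain ⟨t', ⟨ht'S, ht'M⟩, hmin⟩ : ∃ t' ∈ {t' : ι → ℝ | ∀ i ∈ S, 0 ≤ t' i} ∩ {t' | M t' = M t₀},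
      ∀ w ∈ {t' : ι → ℝ | ∀ i ∈ S, 0 ≤ t' i} ∩ {t' | M t' = M t₀},
        ∑ i, (t' i - t i) ^ 2 ≤ ∑ i, (w i - t i) ^ 2 := by
    -- The norm of `ι → ℝ` is the sup norm, which need not drop when some coordinates improve; the
    -- sum of squares does, hence the passage through `EuclideanSpace`.
    have hcl' := hcl.preimage (PiLp.continuous_ofLp 2 (fun _ : ι => ℝ))
    obtain ⟨y, hy, hyd⟩ := hcl'.exists_infDist_eq_dist ⟨WithLp.toLp 2 t₀, ht₀, rfl⟩
      (WithLp.toLp 2 t)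
    refine ⟨y.ofLp, hy, fun w hw => ?_⟩
    have h1 := Metric.infDist_le_dist_of_mem (x := WithLp.toLp 2 t)
      (show WithLp.toLp 2 w ∈ WithLp.ofLp ⁻¹' ({t' : ι → ℝ | ∀ i ∈ S, 0 ≤ t' i} ∩
        {t' | M t' = M t₀}) from hw)
    rw [hyd, dist_comm, dist_comm _ (WithLp.toLp 2 w), EuclideanSpace.dist_eq,
      EuclideanSpace.dist_eq, Real.sqrt_le_sqrt_iff (by positivity)] at h1
    simpa [Real.dist_eq, sq_abs] using h1
  refine ⟨t', ht'S, ht'M, ?_⟩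
  have hcompat : SignCompatible (fun i => SignType.sign (t' i - t i)) (t' - t) := by
    intro i
    simp only [Pi.sub_apply, sign_eq_zero_iff, sign_eq_one_iff, sign_eq_neg_one_iff]
    exact ⟨id, le_of_lt, le_of_lt⟩
  -- If z ≠ 0 were such a kernel vector, t' - e z for small e > 0 would move each coordinate of t'
  -- with z i ≠ 0 towards t without passing it. It would stay feasible and be strictly closer to t,
  -- against the choice of t'.
  have hker : ∀ z, SignCompatible (fun i => SignType.sign (t' i - t i)) z → M z = 0 → z = 0 := by
    intro z hz hMz
    by_contra hz0
    have hz1 : ∀ i, 0 < z i → t i < t' i := by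
      intro i hi
      obtain ⟨h0, h1, h2⟩ := hz i
      rcases lt_trichotomy (t' i - t i) 0 with h | h | h
      · exact absurd (h2 (sign_neg h)) (not_le.2 hi)
      · exact absurd (h0 (by simp [h])) hi.ne'
      · linarith
    have hz2 : ∀ i, z i < 0 → t' i < t i := by
      intro i hi
      obtain ⟨h0, h1, h2⟩ := hz i
      rcases lt_trichotomy (t' i - t i) 0 with h | h | h
      · linarith
      · exact absurd (h0 (by simp [h])) hi.ne
      · exact absurd (h1 (sign_pos h)) (not_le.2 hi)
    -- one step size for all coordinates
    obtain ⟨e, he, hstep⟩ : ∃ e : ℝ, 0 < e ∧ ∀ i, e * |z i| ≤ |t' i - t i| := by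
      have : ∀ i, ∀ᶠ e in 𝓝[>] (0 : ℝ), e * |z i| ≤ |t' i - t i| := by
        intro i
        rcases eq_or_ne (z i) 0 with h | h
        · exact Eventually.of_forall fun e => by simp [h]
        have h1 : 0 < |t' i - t i| := by
          rw [abs_pos, sub_ne_zero]
          rcases lt_or_gt_of_ne h with h | h
          · exact (hz2 i h).ne
          · exact (hz1 i h).ne'
        have h2 : Continuous fun e : ℝ => e * |z i| := by fun_prop
        have h3 : ∀ᶠ e in 𝓝 (0 : ℝ), e * |z i| < |t' i - t i| :=
          h2.continuousAt.eventually_lt continuousAt_const (by simpa using h1)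
        exact nhdsWithin_le_nhds (h3.mono fun _ => le_of_lt)
      obtain ⟨e, h1, h2⟩ := ((eventually_all.2 this).and self_mem_nhdsWithin).exists
      exact ⟨e, h2, h1⟩
    have hcoord : ∀ i, (z i = 0) ∨ (0 < z i ∧ t i ≤ t' i - e * z i) ∨
        (z i < 0 ∧ t' i - e * z i ≤ t i) := by
      intro i
      have h1 := hstep i
      rcases lt_trichotomy (z i) 0 with h | h | h
      · right; right
        have h2 := hz2 i h
        rw [abs_of_neg h, abs_of_neg (by linarith)] at h1
        exact ⟨h, by linarith⟩
      · exact Or.inl h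
      · right; left
        have h2 := hz1 i h
        rw [abs_of_pos h, abs_of_pos (by linarith)] at h1
        exact ⟨h, by linarith⟩
    have hfeas := hmin (t' - e • z) ⟨fun i hi => ?_, ?_⟩
    · obtain ⟨j, hj⟩ : ∃ j, z j ≠ 0 := by
        by_contra! h
        exact hz0 (funext h)
      refine absurd hfeas (not_le.2 (Finset.sum_lt_sum (fun i _ => ?_) ⟨j, Finset.mem_univ j, ?_⟩))
      · simp only [Pi.sub_apply, Pi.smul_apply, smul_eq_mul]
        rcases hcoord i with h | ⟨h, h'⟩ | ⟨h, h'⟩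
        · simp [h]
        · have := mul_pos he h
          nlinarith
        · have := mul_neg_of_pos_of_neg he h
          nlinarith
      · simp only [Pi.sub_apply, Pi.smul_apply, smul_eq_mul]
        rcases hcoord j with h | ⟨h, h'⟩ | ⟨h, h'⟩
        · exact absurd h hj
        · have := mul_pos he h
          nlinarith
        · have := mul_neg_of_pos_of_neg he h
          nlinarith
    · have h1 := ht i hi
      have h2 := ht'S i hi
      simp only [Pi.sub_apply, Pi.smul_apply, smul_eq_mul]
      rcases hcoord i with h | ⟨h, h'⟩ | ⟨h, h'⟩
      · simpa [h] using h2
      · linarith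
      · have := mul_neg_of_pos_of_neg he h
        linarith
    · simp only [Set.mem_ofPred_eq, map_sub, map_smul, hMz, smul_zero, sub_zero]
      exact ht'M
  refine (hκ _ hker _ hcompat).trans ?_
  rw [map_sub, ht'M, norm_sub_rev]
  exact mul_le_mul_of_nonneg_right
    (Finset.single_le_sum (fun σ _ => hκ0 σ) (Finset.mem_univ _)) (norm_nonneg _)

end Hoffman

/-! ### Subdifferential of the grouped regularizer and calmness of its inverse. -/

section GroupLasso

variable {n : ℕ} (𝒥 : Finpartition (Finset.univ : Finset (Fin n))) (ω : Finset (Fin n) → ℝ)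

theorem restrictTo_add (J : Finset (Fin n)) (x y : EuclideanSpace ℝ (Fin n)) :
    restrictTo J (x + y) = restrictTo J x + restrictTo J y := by
  ext i; simp [restrictTo]

theorem restrictTo_sub (J : Finset (Fin n)) (x y : EuclideanSpace ℝ (Fin n)) :
    restrictTo J (x - y) = restrictTo J x - restrictTo J y := by
  ext i; simp [restrictTo]

theorem restrictTo_smul (J : Finset (Fin n)) (a : ℝ) (x : EuclideanSpace ℝ (Fin n)) :
    restrictTo J (a • x) = a • restrictTo J x := by
  ext i; simp [restrictTo]

theorem norm_restrictTo_le (J : Finset (Fin n)) (x : EuclideanSpace ℝ (Fin n)) :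
    ‖restrictTo J x‖ ≤ ‖x‖ := by
  rw [EuclideanSpace.norm_eq, EuclideanSpace.norm_eq]
  refine Real.sqrt_le_sqrt ?_
  have : ∑ i : J, ‖restrictTo J x i‖ ^ 2 = ∑ i ∈ J, ‖x i‖ ^ 2 :=
    Finset.sum_coe_sort J fun i => ‖x i‖ ^ 2
  rw [this]
  exact Finset.sum_le_sum_of_subset_of_nonneg (Finset.subset_univ _) fun _ _ _ => by positivity

theorem abs_apply_le_norm_restrictTo {J : Finset (Fin n)} {i : Fin n} (hi : i ∈ J)
    (x : EuclideanSpace ℝ (Fin n)) : |x i| ≤ ‖restrictTo J x‖ :=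
  PiLp.norm_apply_le (restrictTo J x) ⟨i, hi⟩

theorem sum_inner_restrictTo (x y : EuclideanSpace ℝ (Fin n)) :
    ∑ J ∈ 𝒥.parts, inner ℝ (restrictTo J x) (restrictTo J y) = inner ℝ x y := by
  have h1 : ∀ J : Finset (Fin n), inner ℝ (restrictTo J x) (restrictTo J y) =
      ∑ i ∈ J, inner ℝ (x i) (y i) := fun J =>
    (PiLp.inner_apply _ _).trans (Finset.sum_coe_sort J fun i => inner ℝ (x i) (y i))
  simp only [h1, PiLp.inner_apply]
  conv_rhs => rw [← 𝒥.biUnion_parts]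
  rw [Finset.sum_biUnion]
  · rfl
  · exact fun J hJ K hK hne => 𝒥.disjoint hJ hK hne

/-- Replace the `J`-block of `x` by that of `y`. -/
def replaceOn (J : Finset (Fin n)) (x y : EuclideanSpace ℝ (Fin n)) : EuclideanSpace ℝ (Fin n) :=
  WithLp.toLp 2 fun i => if i ∈ J then y i else x i

theorem restrictTo_replaceOn_self (J : Finset (Fin n)) (x y : EuclideanSpace ℝ (Fin n)) :
    restrictTo J (replaceOn J x y) = restrictTo J y := by
  ext i; simp [restrictTo, replaceOn]

theorem restrictTo_replaceOn_of_disjoint {J K : Finset (Fin n)} (h : Disjoint J K)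
    (x y : EuclideanSpace ℝ (Fin n)) : restrictTo K (replaceOn J x y) = restrictTo K x := by
  ext i
  have : (i : Fin n) ∉ J := fun hi => Finset.disjoint_left.1 h hi i.2
  simp [restrictTo, replaceOn, this]

/-- The subgradient inequality of the grouped regularizer holds block by block. -/
theorem IsSubgradient.restrictTo_le {s x : EuclideanSpace ℝ (Fin n)}
    (h : IsSubgradient (groupLasso 𝒥 ω) s x) {J : Finset (Fin n)} (hJ : J ∈ 𝒥.parts)
    (y : EuclideanSpace ℝ (Fin n)) :
    ω J * ‖restrictTo J x‖ + inner ℝ (restrictTo J s) (restrictTo J y - restrictTo J x) ≤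
      ω J * ‖restrictTo J y‖ := by
  have h1 := h (replaceOn J x y)
  rw [← sum_inner_restrictTo 𝒥] at h1
  simp only [groupLasso] at h1
  rw [← Finset.add_sum_erase _ _ hJ, ← Finset.add_sum_erase _ _ hJ,
    ← Finset.add_sum_erase 𝒥.parts _ hJ] at h1
  have h2 : ∀ K ∈ 𝒥.parts.erase J, restrictTo K (replaceOn J x y) = restrictTo K x :=
    fun K hK => restrictTo_replaceOn_of_disjoint
      (𝒥.disjoint hJ (Finset.mem_of_mem_erase hK) (Finset.ne_of_mem_erase hK).symm) x y
  have h3 : ∑ K ∈ 𝒥.parts.erase J, inner ℝ (restrictTo K s)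
      (restrictTo K (replaceOn J x y - x)) = 0 :=
    Finset.sum_eq_zero fun K hK => by rw [restrictTo_sub, h2 K hK, sub_self, inner_zero_right]
  have h4 : ∑ K ∈ 𝒥.parts.erase J, ω K * ‖restrictTo K (replaceOn J x y)‖ =
      ∑ K ∈ 𝒥.parts.erase J, ω K * ‖restrictTo K x‖ :=
    Finset.sum_congr rfl fun K hK => by rw [h2 K hK]
  rw [h3, h4, restrictTo_sub, restrictTo_replaceOn_self] at h1
  linarith

/-- By positive homogeneity, testing at 0 and 2x gives the equality, and testing at x + s gives the
norm bound. Conversely, Cauchy–Schwarz in each block suffices. -/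
theorem isSubgradient_groupLasso_iff (hω : ∀ J ∈ 𝒥.parts, 0 ≤ ω J)
    {s x : EuclideanSpace ℝ (Fin n)} :
    IsSubgradient (groupLasso 𝒥 ω) s x ↔ ∀ J ∈ 𝒥.parts, ‖restrictTo J s‖ ≤ ω J ∧
      inner ℝ (restrictTo J s) (restrictTo J x) = ω J * ‖restrictTo J x‖ := by
  constructor
  · intro h J hJ
    have h0 := h.restrictTo_le 𝒥 ω hJ ((0 : ℝ) • x)
    have h2 := h.restrictTo_le 𝒥 ω hJ ((2 : ℝ) • x)
    have h1 := h.restrictTo_le 𝒥 ω hJ (x + s)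
    have h3 := norm_add_le (restrictTo J x) (restrictTo J s)
    rw [restrictTo_add, add_sub_cancel_left, real_inner_self_eq_norm_sq] at h1
    rw [restrictTo_smul, norm_smul, inner_sub_right, inner_smul_right] at h0 h2
    norm_num at h0 h2
    refine ⟨?_, by linarith⟩
    by_contra! h4
    nlinarith [mul_le_mul_of_nonneg_left h3 (hω J hJ), hω J hJ]
  · intro h z
    rw [inner_sub_right, ← sum_inner_restrictTo 𝒥 s z, ← sum_inner_restrictTo 𝒥 s x]
    have h1 : groupLasso 𝒥 ω x = ∑ J ∈ 𝒥.parts, inner ℝ (restrictTo J s) (restrictTo J x) :=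
      Finset.sum_congr rfl fun J hJ => (h J hJ).2.symm
    rw [h1, add_sub_cancel]
    refine Finset.sum_le_sum fun J hJ => (real_inner_le_norm _ _).trans ?_
    exact mul_le_mul_of_nonneg_right (h J hJ).1 (norm_nonneg _)

theorem exists_groupLasso_lipschitz (hω : ∀ J ∈ 𝒥.parts, 0 ≤ ω J) :
    ∃ M : ℝ, 0 ≤ M ∧ ∀ x y, groupLasso 𝒥 ω x - groupLasso 𝒥 ω y ≤ M * ‖x - y‖ := by
  refine ⟨∑ J ∈ 𝒥.parts, ω J, Finset.sum_nonneg hω, fun x y => ?_⟩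
  rw [groupLasso, groupLasso, ← Finset.sum_sub_distrib, Finset.sum_mul]
  refine Finset.sum_le_sum fun J hJ => ?_
  rw [← mul_sub]
  refine mul_le_mul_of_nonneg_left ?_ (hω J hJ)
  refine (norm_sub_norm_le _ _).trans ?_
  rw [← restrictTo_sub]
  exact norm_restrictTo_le J _

theorem norm_le_sum_abs (x : EuclideanSpace ℝ (Fin n)) : ‖x‖ ≤ ∑ i, |x i| := by
  rw [EuclideanSpace.norm_eq, Real.sqrt_le_left (Finset.sum_nonneg fun _ _ => abs_nonneg _)]
  simpa using Finset.sum_sq_le_sq_sum_of_nonneg (s := Finset.univ) (f := fun i => |x i|)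
    fun i _ => abs_nonneg _

/-- Linear parametrization of the points at which `s` is a subgradient: the first family of
parameters is used in the blocks without penalty, the second family gives the positions on the rays
spanned by the blocks of `s` of maximal norm. -/
def solutionParam (s : EuclideanSpace ℝ (Fin n)) :
    (Fin n ⊕ Finset (Fin n) → ℝ) →ₗ[ℝ] EuclideanSpace ℝ (Fin n) where
  toFun t := WithLp.toLp 2 fun i =>
    if ω (𝒥.part i) = 0 then t (Sum.inl i)
    else if ‖restrictTo (𝒥.part i) s‖ = ω (𝒥.part i) then t (Sum.inr (𝒥.part i)) * s i else 0
  map_add' t t' := by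
    ext i
    simp only [Pi.add_apply, PiLp.add_apply]
    split_ifs <;> ring
  map_smul' a t := by
    ext i
    simp only [Pi.smul_apply, smul_eq_mul, PiLp.smul_apply, RingHom.id_apply]
    split_ifs <;> ring

theorem solutionParam_apply (s : EuclideanSpace ℝ (Fin n)) (t : Fin n ⊕ Finset (Fin n) → ℝ)
    (i : Fin n) : solutionParam 𝒥 ω s t i =
      if ω (𝒥.part i) = 0 then t (Sum.inl i)
      else if ‖restrictTo (𝒥.part i) s‖ = ω (𝒥.part i) then t (Sum.inr (𝒥.part i)) * s i
      else 0 := rfl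

theorem isSubgradient_solutionParam (hω : ∀ J ∈ 𝒥.parts, 0 ≤ ω J)
    {s : EuclideanSpace ℝ (Fin n)} (hs : ∀ J ∈ 𝒥.parts, ‖restrictTo J s‖ ≤ ω J)
    {t : Fin n ⊕ Finset (Fin n) → ℝ} (ht : ∀ J, 0 ≤ t (Sum.inr J)) :
    IsSubgradient (groupLasso 𝒥 ω) s (solutionParam 𝒥 ω s t) := by
  refine (isSubgradient_groupLasso_iff 𝒥 ω hω).2 fun J hJ => ⟨hs J hJ, ?_⟩
  have hpart : ∀ i ∈ J, 𝒥.part i = J := fun i hi => 𝒥.part_eq_of_mem hJ hi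
  by_cases h0 : ω J = 0
  · have h1 : restrictTo J s = 0 := norm_le_zero_iff.1 (h0 ▸ hs J hJ)
    simp [h0, h1]
  by_cases h1 : ‖restrictTo J s‖ = ω J
  · have h2 : restrictTo J (solutionParam 𝒥 ω s t) = t (Sum.inr J) • restrictTo J s := by
      ext i
      change solutionParam 𝒥 ω s t i = t (Sum.inr J) * s i
      rw [solutionParam_apply, hpart i i.2, if_neg h0, if_pos h1]
    rw [h2, inner_smul_right, real_inner_self_eq_norm_sq, norm_smul, Real.norm_of_nonneg (ht J), h1]
    ring
  · have h2 : restrictTo J (solutionParam 𝒥 ω s t) = 0 := by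
      ext i
      change solutionParam 𝒥 ω s t i = 0
      rw [solutionParam_apply, hpart i i.2, if_neg h0, if_neg h1]
    simp [h2]

/-- Points at which `u` is a subgradient are close to points at which `s` is a subgradient. -/
theorem exists_norm_sub_solutionParam_le (hω : ∀ J ∈ 𝒥.parts, 0 ≤ ω J)
    {s : EuclideanSpace ℝ (Fin n)} (hs : ∀ J ∈ 𝒥.parts, ‖restrictTo J s‖ ≤ ω J) {B : ℝ}
    (hB : 0 ≤ B) :
    ∃ κ : ℝ, 0 ≤ κ ∧ ∀ p u, ‖p‖ ≤ B → IsSubgradient (groupLasso 𝒥 ω) u p →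
      ∃ t : Fin n ⊕ Finset (Fin n) → ℝ, (∀ J, 0 ≤ t (Sum.inr J)) ∧
        ‖p - solutionParam 𝒥 ω s t‖ ≤ κ * ‖u - s‖ := by
  have hmem : ∀ i, 𝒥.part i ∈ 𝒥.parts := fun i => 𝒥.part_mem.2 (Finset.mem_univ i)
  have hself : ∀ i, i ∈ 𝒥.part i := fun i => 𝒥.mem_part (Finset.mem_univ i)
  -- The ray parameter is the one for which p_J = (‖p_J‖ / ω_J) u_J. The absolute value keeps it
  -- nonnegative for finsets J outside the partition too.
  suffices h : ∀ i, ∃ κ : ℝ, 0 ≤ κ ∧ ∀ p u, ‖p‖ ≤ B → IsSubgradient (groupLasso 𝒥 ω) u p →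
      |(p - solutionParam 𝒥 ω s
        (Sum.elim (fun i => p i) fun J => ‖restrictTo J p‖ / |ω J|)) i| ≤ κ * ‖u - s‖ by
    choose κ hκ0 hκ using h
    refine ⟨∑ i, κ i, Finset.sum_nonneg fun i _ => hκ0 i, fun p u hp hu =>
      ⟨Sum.elim (fun i => p i) fun J => ‖restrictTo J p‖ / |ω J|,
        fun J => by simp only [Sum.elim_inr]; positivity, (norm_le_sum_abs _).trans ?_⟩⟩
    rw [Finset.sum_mul]
    exact Finset.sum_le_sum fun i _ => hκ i p u hp hu
  intro i
  set J := 𝒥.part i with hJ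
  have hω0 := hω J (hmem i)
  by_cases h0 : ω J = 0
  · refine ⟨0, le_rfl, fun p u _ _ => ?_⟩
    rw [PiLp.sub_apply, solutionParam_apply, ← hJ, if_pos h0]
    simp
  have hpos : 0 < ω J := lt_of_le_of_ne hω0 (Ne.symm h0)
  have hsub : ∀ u, |u i - s i| ≤ ‖u - s‖ := fun u => PiLp.norm_apply_le (u - s) i
  by_cases h1 : ‖restrictTo J s‖ = ω J
  · refine ⟨B / ω J, by positivity, fun p u hp hu => ?_⟩
    obtain ⟨h2, h3⟩ := (isSubgradient_groupLasso_iff 𝒥 ω hω).1 hu J (hmem i)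
    -- Equality case of Cauchy–Schwarz: the squared norm of the difference is ‖p_J‖² (‖u_J‖² - ω_J²)
    -- ≤ 0.
    have h4 : ω J • restrictTo J p = ‖restrictTo J p‖ • restrictTo J u := by
      refine sub_eq_zero.1 (norm_eq_zero.1 (pow_eq_zero_iff two_ne_zero |>.1
        (le_antisymm ?_ (sq_nonneg _))))
      rw [norm_sub_sq_real, norm_smul,
        norm_smul, inner_smul_left, inner_smul_right, real_inner_comm, h3, norm_norm,
        Real.norm_of_nonneg hω0]
      simp only [conj_trivial]
      have := mul_le_mul_of_nonneg_left (pow_le_pow_left₀ (norm_nonneg _) h2 2)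
        (sq_nonneg ‖restrictTo J p‖)
      nlinarith
    have h5 : ω J * p i = ‖restrictTo J p‖ * u i :=
      congrArg (fun v : EuclideanSpace ℝ J => v ⟨i, hself i⟩) h4
    rw [PiLp.sub_apply, solutionParam_apply, ← hJ, if_neg h0, if_pos h1, Sum.elim_inr, abs_of_pos hpos]
    have h6 : p i - ‖restrictTo J p‖ / ω J * s i = ‖restrictTo J p‖ / ω J * (u i - s i) := by
      field_simp
      linarith
    rw [h6, abs_mul, abs_of_nonneg (by positivity)]
    gcongr
    · exact (norm_restrictTo_le J p).trans hp
    · exact hsub u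
  -- If p_J ≠ 0 then ‖u_J‖ ≥ ω_J, so ‖u - s‖ is at least the gap ω_J - ‖s_J‖, and the crude bound
  -- ‖p_J‖ ≤ B is enough.
  · have hlt : 0 < ω J - ‖restrictTo J s‖ := sub_pos.2 (lt_of_le_of_ne (hs J (hmem i)) h1)
    refine ⟨B / (ω J - ‖restrictTo J s‖), by positivity, fun p u hp hu => ?_⟩
    obtain ⟨h2, h3⟩ := (isSubgradient_groupLasso_iff 𝒥 ω hω).1 hu J (hmem i)
    rw [PiLp.sub_apply, solutionParam_apply, ← hJ, if_neg h0, if_neg h1, sub_zero]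
    refine (abs_apply_le_norm_restrictTo (hself i) p).trans ?_
    rw [← hJ]
    rcases (norm_nonneg (restrictTo J p)).eq_or_lt with hp0 | hp0
    · rw [← hp0]; positivity
    have h4 : ω J ≤ ‖restrictTo J u‖ := by
      have := real_inner_le_norm (restrictTo J u) (restrictTo J p)
      rw [h3] at this
      exact le_of_mul_le_mul_right this hp0
    have h5 : ω J - ‖restrictTo J s‖ ≤ ‖u - s‖ := by
      refine (sub_le_sub_right h4 _).trans ((norm_sub_norm_le _ _).trans ?_)
      rw [← restrictTo_sub]
      exact norm_restrictTo_le J _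
    rw [div_mul_eq_mul_div, le_div_iff₀ hlt]
    exact mul_le_mul ((norm_restrictTo_le J p).trans hp) h5 hlt.le hB

/-- Upper Lipschitz continuity of the solution map `(y, s) ↦ {x | A x = y, s ∈ ∂P x}` of the grouped
LASSO regularizer `P`. -/
theorem exists_upperLipschitz_groupLasso {T : Type*} [NormedAddCommGroup T] [NormedSpace ℝ T]
    (hω : ∀ J ∈ 𝒥.parts, 0 ≤ ω J) (A : EuclideanSpace ℝ (Fin n) →L[ℝ] T)
    {s x₀ : EuclideanSpace ℝ (Fin n)} (hx₀ : IsSubgradient (groupLasso 𝒥 ω) s x₀) (B : ℝ) :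
    ∃ κ : ℝ, 0 ≤ κ ∧ ∀ p u, ‖p‖ ≤ B → IsSubgradient (groupLasso 𝒥 ω) u p →
      ∃ x, A x = A x₀ ∧ IsSubgradient (groupLasso 𝒥 ω) s x ∧
        ‖p - x‖ ≤ κ * (‖A p - A x₀‖ + ‖u - s‖) := by
  have hs : ∀ J ∈ 𝒥.parts, ‖restrictTo J s‖ ≤ ω J := fun J hJ =>
    ((isSubgradient_groupLasso_iff 𝒥 ω hω).1 hx₀ J hJ).1
  obtain ⟨κ₁, hκ₁, h₁⟩ := exists_norm_sub_solutionParam_le 𝒥 ω hω hs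
    (le_max_right (max B ‖x₀‖) 0)
  set N := solutionParam 𝒥 ω s
  obtain ⟨κ₂, hκ₂, h₂⟩ := exists_hoffman_bound (A.toLinearMap ∘ₗ N) (Set.range Sum.inr)
  -- At p = x₀, u = s the error is κ₁ · 0, so x₀ itself is parametrized; the radius was enlarged to
  -- include ‖x₀‖ for this.
  obtain ⟨t₀, ht₀, hxt₀⟩ := h₁ x₀ s (le_max_of_le_left (le_max_right _ _)) hx₀
  have hN₀ : N t₀ = x₀ := by
    rw [sub_self, norm_zero, mul_zero, norm_le_zero_iff, sub_eq_zero] at hxt₀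
    exact hxt₀.symm
  set Nc : (Fin n ⊕ Finset (Fin n) → ℝ) →L[ℝ] EuclideanSpace ℝ (Fin n) :=
    LinearMap.toContinuousLinearMap N
  refine ⟨κ₁ + ‖Nc‖ * (κ₂ * (1 + ‖A‖ * κ₁)), by positivity, fun p u hp hu => ?_⟩
  obtain ⟨t, ht, hpt⟩ := h₁ p u (le_max_of_le_left (hp.trans (le_max_left _ _))) hu
  obtain ⟨t', ht', hMt', htt'⟩ := h₂ t t₀ (by rintro _ ⟨J, rfl⟩; exact ht J)
    (by rintro _ ⟨J, rfl⟩; exact ht₀ J)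
  refine ⟨N t', ?_, isSubgradient_solutionParam 𝒥 ω hω hs fun J => ht' _ ⟨J, rfl⟩, ?_⟩
  · have : A (N t') = A (N t₀) := hMt'
    rw [this, hN₀]
  have h3 : ‖(A.toLinearMap ∘ₗ N) t - (A.toLinearMap ∘ₗ N) t₀‖ ≤
      ‖A p - A x₀‖ + ‖A‖ * (κ₁ * ‖u - s‖) := by
    have h4 : (A.toLinearMap ∘ₗ N) t - (A.toLinearMap ∘ₗ N) t₀ =
        (A p - A x₀) - A (p - N t) := by
      simp [hN₀]
    rw [h4]
    refine (norm_sub_le _ _).trans (add_le_add_right ?_ _)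
    exact (A.le_opNorm _).trans (mul_le_mul_of_nonneg_left hpt (norm_nonneg _))
  have h5 : ‖N t - N t'‖ ≤ ‖Nc‖ * ‖t' - t‖ := by
    rw [norm_sub_rev, ← map_sub]
    exact Nc.le_opNorm _
  have h6 : ‖p - N t'‖ ≤ ‖p - N t‖ + ‖N t - N t'‖ := norm_sub_le_norm_sub_add_norm_sub _ _ _
  have h7 : ‖N t - N t'‖ ≤ ‖Nc‖ * (κ₂ * (‖A p - A x₀‖ + ‖A‖ * (κ₁ * ‖u - s‖))) :=
    h5.trans (by gcongr; exact htt'.trans (by gcongr))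
  have h8 : ‖A p - A x₀‖ + ‖A‖ * (κ₁ * ‖u - s‖) ≤
      (1 + ‖A‖ * κ₁) * (‖A p - A x₀‖ + ‖u - s‖) := by
    have : 0 ≤ ‖A‖ * κ₁ * ‖A p - A x₀‖ := by positivity
    nlinarith [norm_nonneg (u - s)]
  have h9 : ‖N t - N t'‖ ≤ ‖Nc‖ * (κ₂ * ((1 + ‖A‖ * κ₁) * (‖A p - A x₀‖ + ‖u - s‖))) :=
    h7.trans (by gcongr)
  have h10 : κ₁ * ‖u - s‖ ≤ κ₁ * (‖A p - A x₀‖ + ‖u - s‖) := by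
    gcongr; exact le_add_of_nonneg_left (norm_nonneg _)
  linarith

end GroupLasso

/-! ### Small residuals force proximity to the optimal set. -/

section Localization

variable {E : Type*} [NormedAddCommGroup E] [InnerProductSpace ℝ E]

/-- A point with an approximate stationarity relation is approximately optimal. -/
theorem objective_gap_le [CompleteSpace E] {D : Set E} {φ P : E → ℝ} (hφ : ConvexOn ℝ D φ) {M : ℝ}
    (hM0 : 0 ≤ M) (hM : ∀ x y, P x - P y ≤ M * ‖x - y‖) {x y g R : E} (hx : x ∈ D) (hy : y ∈ D)
    (hg : HasGradientAt φ g x) (hR : IsSubgradient P (-g - R) (x + R)) :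
    φ x + P x - (φ y + P y) ≤ ‖R‖ * (2 * M + 2 * ‖R‖ + ‖x - y‖) := by
  have h1 := inner_gradient_le_of_convexOn hφ hg hx hy
  have h2 := hR y
  have h3 := hR.norm_le hM hM0
  have h4 := hM x (x + R)
  have h5 : ‖x - (x + R)‖ = ‖R‖ := by simp
  have h6 : inner ℝ (-g - R) (y - (x + R)) =
      -inner ℝ g (y - x) - inner ℝ (-g - R) R - inner ℝ R (y - x) := by
    have : y - (x + R) = (y - x) - R := by abel
    rw [this, inner_sub_right]
    simp only [inner_sub_left, inner_neg_left]
    ring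
  have h7 := real_inner_le_norm (-g - R) R
  have h8 := real_inner_le_norm R (y - x)
  have h9 := mul_le_mul_of_nonneg_right h3 (norm_nonneg R)
  rw [norm_sub_rev y x] at h8
  rw [h5] at h4
  nlinarith [sq_nonneg ‖R‖]

/-- On the compact set at distance δ from X the objective exceeds v by some η > 0. By convexity the
excess at distance r > δ is at least η r / δ, whereas `objective_gap_le` bounds it by ‖R‖ (2M + 2‖R‖
+ r). -/
theorem exists_infDist_le_of_residual_le [FiniteDimensional ℝ E] {D : Set E} {φ P : E → ℝ}
    (hφ : ConvexOn ℝ D φ) (hφc : ContinuousOn φ D) (hP : ConvexOn ℝ Set.univ P) {M : ℝ}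
    (hM0 : 0 ≤ M) (hM : ∀ x y, P x - P y ≤ M * ‖x - y‖) {X : Set E} {v : ℝ}
    (hXv : ∀ x ∈ X, φ x + P x = v)
    (hX : ∀ x ∈ D, φ x + P x ≤ v → x ∈ X) (hne : X.Nonempty) (hcpt : IsCompact X) {δ : ℝ}
    (hδ : 0 < δ) (hD : Metric.cthickening δ X ⊆ D) :
    ∃ ε : ℝ, 0 < ε ∧ ∀ x ∈ D, ∀ g R, HasGradientAt φ g x →
      IsSubgradient P (-g - R) (x + R) → ‖R‖ ≤ ε → Metric.infDist x X ≤ δ := by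
  have hPc : Continuous P := by
    simpa using (hP.continuousOn_interior)
  have hXD : X ⊆ D := (Metric.self_subset_cthickening X).trans hD
  have hsph : {y | Metric.infDist y X = δ} ⊆ Metric.cthickening δ X := fun y hy => by
    rw [hcpt.cthickening_eq_biUnion_closedBall hδ.le]
    obtain ⟨z, hz, hyz⟩ := hcpt.exists_infDist_eq_dist hne y
    refine Set.mem_biUnion hz ?_
    rw [Metric.mem_closedBall, ← hyz]
    exact le_of_eq hy
  have hscpt : IsCompact {y | Metric.infDist y X = δ} :=
    hcpt.cthickening.of_isClosed_subset
      (isClosed_eq (Metric.continuous_infDist_pt X) continuous_const) hsph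
  obtain ⟨η, hη, hgrow⟩ : ∃ η : ℝ, 0 < η ∧ ∀ y, Metric.infDist y X = δ → v + η ≤ φ y + P y := by
    rcases {y | Metric.infDist y X = δ}.eq_empty_or_nonempty with h | h
    · exact ⟨1, one_pos, fun y hy => absurd (show y ∈ {y | Metric.infDist y X = δ} from hy)
        (by simp [h])⟩
    obtain ⟨y₀, hy₀, hmin⟩ := hscpt.exists_isMinOn h
      ((hφc.mono (hsph.trans hD)).add hPc.continuousOn)
    refine ⟨φ y₀ + P y₀ - v, ?_, fun y hy => ?_⟩
    · by_contra! hle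
      have h1 := hX y₀ (hD (hsph hy₀)) (by linarith)
      have h2 : Metric.infDist y₀ X = δ := hy₀
      rw [Metric.infDist_zero_of_mem h1] at h2
      exact hδ.ne h2
    · have : φ y₀ + P y₀ ≤ φ y + P y := hmin hy
      linarith
  -- The three bounds give 2‖R‖ ≤ 2, ‖R‖ (2M + 2) ≤ η/2 and ‖R‖ δ ≤ η/4, so the final estimate would
  -- read η ≤ 3η/4.
  refine ⟨min 1 (min (η / (2 * (2 * M + 2))) (η / (2 * δ) / 2)), by positivity,
    fun x hx g R hg hR hRε => ?_⟩
  by_contra! hlt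
  obtain ⟨z, hz, hxz⟩ := hcpt.exists_infDist_eq_dist hne x
  rw [dist_eq_norm] at hxz
  rw [hxz] at hlt
  set r := ‖x - z‖ with hr
  have hr0 : 0 < r := hδ.trans hlt
  set τ := δ / r with hτ
  have hτ0 : 0 < τ := by positivity
  have hτ1 : τ ≤ 1 := (div_le_one hr0).2 hlt.le
  have hτr : τ * r = δ := by rw [hτ]; field_simp
  -- The point at distance exactly δ from X on the segment from the projection z to x.
  set y := (1 - τ) • z + τ • x with hy
  have hyz : y - z = τ • (x - z) := by rw [hy]; module
  have hxy : x - y = (1 - τ) • (x - z) := by rw [hy]; module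
  have hyd : Metric.infDist y X = δ := by
    apply le_antisymm
    · refine (Metric.infDist_le_dist_of_mem hz).trans (le_of_eq ?_)
      rw [dist_eq_norm, hyz, norm_smul, Real.norm_of_nonneg hτ0.le, ← hr, hτr]
    · have h1 := Metric.infDist_le_infDist_add_dist (s := X) (x := x) (y := y)
      rw [hxz, dist_eq_norm, hxy, norm_smul, Real.norm_of_nonneg (by linarith), ← hr] at h1
      linarith
  have h1 := hgrow y hyd
  have h2 := hφ.2 (hXD hz) hx (by linarith : 0 ≤ 1 - τ) hτ0.le (by ring)
  have h3 := hP.2 (Set.mem_univ z) (Set.mem_univ x) (by linarith : 0 ≤ 1 - τ) hτ0.le (by ring)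
  rw [← hy] at h2 h3
  simp only [smul_eq_mul] at h2 h3
  have h4 := objective_gap_le hφ hM0 hM hx (hXD hz) hg hR
  have h5 := hXv z hz
  rw [h5, ← hr] at h4
  have h6 : η ≤ τ * (φ x + P x - v) := by
    rw [← h5] at h1 ⊢
    linarith
  have hR1 : ‖R‖ ≤ 1 := hRε.trans (min_le_left _ _)
  have hR2 : ‖R‖ * (2 * (2 * M + 2)) ≤ η := by
    rw [← le_div_iff₀ (by positivity)]
    exact hRε.trans ((min_le_right _ _).trans (min_le_left _ _))
  have hR3 : ‖R‖ * (4 * δ) ≤ η := by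
    rw [← le_div_iff₀ (by positivity)]
    refine hRε.trans ((min_le_right _ _).trans ((min_le_right _ _).trans (le_of_eq ?_)))
    field_simp
    norm_num
  have h7 : τ * (φ x + P x - v) ≤ τ * (‖R‖ * (2 * M + 2 + r)) := by
    refine mul_le_mul_of_nonneg_left (h4.trans ?_) hτ0.le
    exact mul_le_mul_of_nonneg_left (by linarith) (norm_nonneg _)
  have h8 : τ * (‖R‖ * (2 * M + 2 + r)) = τ * (‖R‖ * (2 * M + 2)) + ‖R‖ * δ := by
    rw [← hτr]; ring
  have h9 : τ * (‖R‖ * (2 * M + 2)) ≤ ‖R‖ * (2 * M + 2) :=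
    mul_le_of_le_one_left (by positivity) hτ1
  linarith

end Localization

/-! ### The error bound for a regularizer with calm inverse subdifferential. -/

section Structure

variable {E T : Type*} [NormedAddCommGroup E] [InnerProductSpace ℝ E] [FiniteDimensional ℝ E]
  [NormedAddCommGroup T] [InnerProductSpace ℝ T] [FiniteDimensional ℝ T]

theorem IsAdmissible.coe_realPart {h : T → EReal} (hh : IsAdmissible h) {y : T}
    (hy : y ∈ effDom h) : ((realPart h y : ℝ) : EReal) = h y :=
  EReal.coe_toReal (ne_of_lt hy) (hh.ne_bot y)

theorem IsAdmissible.convexOn_realPart {h : T → EReal} (hh : IsAdmissible h) :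
    ConvexOn ℝ (effDom h) (realPart h) := by
  have key : ∀ x ∈ effDom h, ∀ y ∈ effDom h, ∀ a b : ℝ, 0 ≤ a → 0 ≤ b → a + b = 1 →
      h (a • x + b • y) ≤ ((a * realPart h x + b * realPart h y : ℝ) : EReal) := by
    intro x hx y hy a b ha hb hab
    exact hh.convex (x := (x, realPart h x)) (y := (y, realPart h y))
      (hh.coe_realPart hx).ge (hh.coe_realPart hy).ge ha hb hab
  have hconv : Convex ℝ (effDom h) := fun x hx y hy a b ha hb hab =>
    (key x hx y hy a b ha hb hab).trans_lt (EReal.coe_lt_top _)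
  refine ⟨hconv, fun x hx y hy a b ha hb hab => ?_⟩
  have h1 := key x hx y hy a b ha hb hab
  rw [← hh.coe_realPart (hconv hx hy ha hb hab), EReal.coe_le_coe_iff] at h1
  exact h1

theorem IsAdmissible.hasGradientAt {h : T → EReal} (hh : IsAdmissible h) {y : T}
    (hy : y ∈ effDom h) : HasGradientAt (realPart h) (∇ (realPart h) y) y :=
  ((hh.contDiffOn.differentiableOn (by norm_num)).differentiableAt
    (hh.dom_open.mem_nhds hy)).hasGradientAt

theorem _root_.HasGradientAt.comp_linear_add_inner {φ : T → ℝ} {g : T} {A : E →L[ℝ] T} {x : E}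
    (hφ : HasGradientAt φ g (A x)) (c : E) :
    HasGradientAt (fun z => φ (A z) + inner ℝ c z) (A.adjoint g + c) x := by
  rw [hasGradientAt_iff_hasFDerivAt]
  have h1 := hφ.hasFDerivAt.comp x A.hasFDerivAt
  have h2 : HasFDerivAt (fun z : E => inner ℝ c z) (innerSL ℝ c) x := (innerSL ℝ c).hasFDerivAt
  have h3 : InnerProductSpace.toDual ℝ E (A.adjoint g + c) =
      (InnerProductSpace.toDual ℝ T g).comp A + innerSL ℝ c := by
    ext z
    simp [ContinuousLinearMap.adjoint_inner_left]
  rw [h3]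
  exact h1.add h2

/-- The grouped structure enters only through `hcalm`; the rest needs a convex Lipschitz P. -/
theorem exists_infDist_le_mul_norm_residual {D : Set T} {ψ : T → ℝ} {γ : T → T} (hψ : ConvexOn ℝ D ψ)
    (hDo : IsOpen D) (hγ : ∀ y ∈ D, HasGradientAt ψ (γ y) y)
    (hstrong : ∀ V : Set T, IsCompact V → Convex ℝ V → V ⊆ D →
      ∃ σ : ℝ, 0 < σ ∧ StrongConvexOn V σ ψ)
    (hlip : ∀ V : Set T, IsCompact V → Convex ℝ V → V ⊆ D → ∃ L : NNReal, LipschitzOnWith L γ V)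
    (A : E →L[ℝ] T) (c : E) {P : E → ℝ} (hP : ConvexOn ℝ Set.univ P) {M : ℝ}
    (hM0 : 0 ≤ M) (hM : ∀ x y, P x - P y ≤ M * ‖x - y‖)
    (hcalm : ∀ s x₀, IsSubgradient P s x₀ → ∀ B : ℝ, ∃ κ : ℝ, 0 ≤ κ ∧ ∀ p u, ‖p‖ ≤ B →
      IsSubgradient P u p → ∃ x, A x = A x₀ ∧ IsSubgradient P s x ∧
        ‖p - x‖ ≤ κ * (‖A p - A x₀‖ + ‖u - s‖))
    {X : Set E} (hX : X = {x | A x ∈ D ∧ ∀ z, A z ∈ D →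
      ψ (A x) + inner ℝ c x + P x ≤ ψ (A z) + inner ℝ c z + P z})
    (hne : X.Nonempty) (hcpt : IsCompact X) :
    ∃ κ : ℝ, 0 < κ ∧ ∃ ε : ℝ, 0 < ε ∧ ∀ x, A x ∈ D → ∀ R,
      IsSubgradient P (-(A.adjoint (γ (A x)) + c) - R) (x + R) → ‖R‖ ≤ ε →
        Metric.infDist x X ≤ κ * ‖R‖ := by
  set φ : E → ℝ := fun x => ψ (A x) + inner ℝ c x with hφdef
  set g : E → E := fun x => A.adjoint (γ (A x)) + c with hgdef
  set D' : Set E := A ⁻¹' D with hD'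
  have hD'o : IsOpen D' := hDo.preimage A.continuous
  have hg : ∀ x ∈ D', HasGradientAt φ (g x) x := fun x hx =>
    (hγ (A x) hx).comp_linear_add_inner c
  have hφ : ConvexOn ℝ D' φ := by
    refine (hψ.comp_linearMap A.toLinearMap).add ⟨hψ.1.linear_preimage A.toLinearMap, ?_⟩
    intro x _ y _ a b _ _ _
    simp [inner_add_right, inner_smul_right]
  have hφc : ContinuousOn φ D' := fun x hx => (hg x hx).continuousAt.continuousWithinAt
  have hXD : X ⊆ D' := fun x hx => by rw [hX] at hx; exact hx.1
  obtain ⟨x₀, hx₀⟩ := hne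
  have hx₀' := hx₀
  rw [hX] at hx₀'
  obtain ⟨hx₀D, hx₀min⟩ := hx₀'
  have hXle : ∀ x ∈ D', φ x + P x ≤ φ x₀ + P x₀ → x ∈ X := fun x hx hle => by
    rw [hX]
    exact ⟨hx, fun z hz => hle.trans (hx₀min z hz)⟩
  have hXv : ∀ x ∈ X, φ x + P x = φ x₀ + P x₀ := fun x hx => by
    rw [hX] at hx
    exact le_antisymm (hx.2 x₀ hx₀D) (hx₀min x hx.1)
  have hXconv : Convex ℝ X := by
    have h1 := (hφ.add (hP.subset (Set.subset_univ _) hφ.1)).convex_le (φ x₀ + P x₀)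
    convert h1 using 1
    ext x
    exact ⟨fun hx => ⟨hXD hx, (hXv x hx).le⟩, fun hx => hXle x hx.1 hx.2⟩
  obtain ⟨δ, hδ, hδD⟩ := hcpt.exists_cthickening_subset_open hD'o hXD
  obtain ⟨ε, hε, hloc⟩ := exists_infDist_le_of_residual_le hφ hφc hP hM0 hM hXv hXle
    ⟨x₀, hx₀⟩ hcpt hδ hδD
  -- K is compact and, as X is convex, convex; so the local constants of ψ exist on A(K).
  set K := Metric.cthickening δ X with hK
  have hKc : IsCompact K := hcpt.cthickening
  have hXK : X ⊆ K := Metric.self_subset_cthickening X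
  have hVc : IsCompact (A '' K) := hKc.image A.continuous
  have hVconv : Convex ℝ (A '' K) := (hXconv.cthickening δ).linear_image A.toLinearMap
  have hVD : A '' K ⊆ D := Set.image_subset_iff.2 hδD
  obtain ⟨σ, hσ, hstr⟩ := hstrong _ hVc hVconv hVD
  obtain ⟨L, hL⟩ := hlip _ hVc hVconv hVD
  obtain ⟨B, hB⟩ := hKc.isBounded.exists_norm_le
  have hs₀ : IsSubgradient P (-g x₀) x₀ :=
    isSubgradient_neg_of_forall_le hP hφ.1 hD'o hx₀D (hg x₀ hx₀D) hx₀min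
  obtain ⟨κ, hκ, hcalm⟩ := hcalm _ _ hs₀ (B + 1)
  set L' : ℝ := ‖A‖ * L with hL'
  have hL'0 : 0 ≤ L' := by positivity
  set c₁ : ℝ := L' + κ * (1 + L') with hc₁
  set c₂ : ℝ := κ * (‖A‖ + 1) with hc₂
  -- Chosen so that ‖A x - A w‖ ≤ ρ ‖R‖: the 1 covers ‖A x - A w‖ ≤ ‖R‖, the quotient the opposite
  -- case.
  set ρ : ℝ := max 1 ((c₁ + c₂) / σ) with hρ
  have hρ1 : 1 ≤ ρ := le_max_left _ _
  refine ⟨1 + (κ * (1 + L') * ρ + c₂), by positivity, min 1 ε, by positivity,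
    fun x hx R hR hRε => ?_⟩
  have hxX : Metric.infDist x X ≤ δ :=
    hloc x hx (g x) R (hg x hx) hR (hRε.trans (min_le_right _ _))
  have hxK : x ∈ K := by
    obtain ⟨z, hz, hxz⟩ := hcpt.exists_infDist_eq_dist ⟨x₀, hx₀⟩ x
    exact Metric.mem_cthickening_of_dist_le x z δ X hz (hxz ▸ hxX)
  have hpB : ‖x + R‖ ≤ B + 1 :=
    (norm_add_le _ _).trans (add_le_add (hB x hxK) (hRε.trans (min_le_left _ _)))
  obtain ⟨w, hAw, hws, hpw⟩ := hcalm _ _ hpB hR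
  have hwD : w ∈ D' := by
    change A w ∈ D
    rw [hAw]
    exact hx₀D
  have hgw : g w = g x₀ := by simp only [hgdef, hAw]
  have hwX : w ∈ X := by
    refine hXle w hwD ?_
    have h1 := inner_gradient_le_of_convexOn hφ (hg w hwD) hwD hx₀D
    have h2 := hws x₀
    rw [inner_neg_left] at h2
    rw [hgw] at h1
    linarith
  have hAdj : ‖g x - g w‖ ≤ L' * ‖A x - A w‖ := by
    have h1 : g x - g w = A.adjoint (γ (A x) - γ (A w)) := by
      simp only [hgdef, map_sub]; abel
    have h2 := hL.dist_le_mul _ ⟨x, hxK, rfl⟩ _ ⟨w, hXK hwX, rfl⟩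
    rw [dist_eq_norm, dist_eq_norm] at h2
    rw [h1]
    refine (A.adjoint.le_opNorm _).trans ?_
    rw [LinearIsometryEquiv.norm_map, hL', mul_assoc]
    exact mul_le_mul_of_nonneg_left h2 (norm_nonneg _)
  rw [← hgw] at hpw hws
  rw [← hAw] at hpw
  set a := ‖A x - A w‖ with ha
  set r := ‖R‖ with hr
  set d := ‖x + R - w‖ with hd
  have ha0 : 0 ≤ a := norm_nonneg _
  have hr0 : 0 ≤ r := norm_nonneg _
  have hd0 : 0 ≤ d := norm_nonneg _
  have hdle : d ≤ κ * (1 + L') * a + c₂ * r := by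
    have h1 : ‖A (x + R) - A w‖ ≤ a + ‖A‖ * r := by
      have : A (x + R) - A w = (A x - A w) + A R := by rw [map_add]; abel
      rw [this]
      exact (norm_add_le _ _).trans (add_le_add_right (A.le_opNorm R) _)
    have h2 : ‖-g x - R - -g w‖ ≤ L' * a + r := by
      have : -g x - R - -g w = -(g x - g w) - R := by abel
      rw [this]
      refine (norm_sub_le _ _).trans ?_
      rw [norm_neg]
      exact add_le_add_left hAdj _
    refine hpw.trans ((mul_le_mul_of_nonneg_left (add_le_add h1 h2) hκ).trans (le_of_eq ?_))
    rw [hc₂]; ring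
  -- Strong monotonicity of γ bounds ⟪g x - g w, x - w⟫ below; monotonicity of ∂P at x + R and w
  -- bounds it above, with error terms containing R.
  have hmono : σ * a ^ 2 ≤ r * (L' * a + d) := by
    have h1 := inner_gradient_sub_ge_of_strongConvexOn hstr (hγ (A x) hx) (hγ (A w) hwD)
      ⟨x, hxK, rfl⟩ ⟨w, hXK hwX, rfl⟩
    have h2 : inner ℝ (γ (A x) - γ (A w)) (A x - A w) = inner ℝ (g x - g w) (x - w) := by
      rw [← map_sub A, ← ContinuousLinearMap.adjoint_inner_left]
      congr 1
      simp only [hgdef, map_sub]; abel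
    have h3 := hR.inner_sub_nonneg hws
    have h4 : inner ℝ (-g x - R - -g w) (x + R - w) =
        -inner ℝ (g x - g w) (x - w) - inner ℝ (g x - g w) R - inner ℝ R (x + R - w) := by
      have e1 : -g x - R - -g w = -(g x - g w) - R := by abel
      have e2 : x + R - w = (x - w) + R := by abel
      rw [e1, inner_sub_left, inner_neg_left]
      nth_rewrite 1 [e2]
      rw [inner_add_right]
      ring
    change 0 ≤ inner ℝ (-g x - R - -g w) (x + R - w) at h3
    have h5 : -inner ℝ (g x - g w) R ≤ L' * a * r := by
      have := abs_real_inner_le_norm (g x - g w) R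
      have h6 := mul_le_mul_of_nonneg_right hAdj hr0
      linarith [neg_abs_le (inner ℝ (g x - g w) R : ℝ)]
    have h6 : -inner ℝ R (x + R - w) ≤ r * d := by
      have := abs_real_inner_le_norm R (x + R - w)
      linarith [neg_abs_le (inner ℝ R (x + R - w) : ℝ)]
    rw [h2] at h1
    linarith
  have hale : a ≤ ρ * r := by
    rcases le_total a r with har | har
    · exact har.trans (le_mul_of_one_le_left hr0 hρ1)
    rcases ha0.eq_or_lt with h0 | h0
    · rw [← h0]; positivity
    have h1 : σ * a ^ 2 ≤ r * (c₁ + c₂) * a := by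
      have h2 : r * (L' * a + d) ≤ r * (c₁ * a + c₂ * r) :=
        mul_le_mul_of_nonneg_left (by rw [hc₁]; linarith) hr0
      have h3 : r * (c₁ * a + c₂ * r) ≤ r * (c₁ * a + c₂ * a) := by gcongr
      linarith
    have h2 : σ * a ≤ r * (c₁ + c₂) := by
      refine le_of_mul_le_mul_right ?_ h0
      linarith
    have h3 : a ≤ (c₁ + c₂) / σ * r := by
      rw [div_mul_eq_mul_div, le_div_iff₀ hσ]
      linarith
    exact h3.trans (mul_le_mul_of_nonneg_right (le_max_right _ _) hr0)
  calc Metric.infDist x X ≤ dist x w := Metric.infDist_le_dist_of_mem hwX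
    _ ≤ r + d := by
      rw [dist_eq_norm]
      have : x - w = (x + R - w) - R := by abel
      rw [this]
      linarith [norm_sub_le (x + R - w) R]
    _ ≤ r + (κ * (1 + L') * (ρ * r) + c₂ * r) := by
      have := mul_le_mul_of_nonneg_left hale (by positivity : 0 ≤ κ * (1 + L'))
      linarith
    _ = (1 + (κ * (1 + L') * ρ + c₂)) * r := by ring

end Structure

/-! ### From the extended-valued objective to real-valued functions on the domain. -/

section Loss

theorem objective_loss_lt_top_iff {E T : Type*} [NormedAddCommGroup E]
    [InnerProductSpace ℝ E] [NormedAddCommGroup T] [InnerProductSpace ℝ T] {h : T → EReal}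
    (A : E →ₗ[ℝ] T) (c : E) (P : E → ℝ) {x : E} :
    objective (loss h A c) P x < ⊤ ↔ A x ∈ effDom h := by
  constructor
  · intro hx
    change h (A x) < ⊤
    refine lt_top_iff_ne_top.2 fun htop => ?_
    rw [objective, loss, htop, EReal.top_add_coe, EReal.top_add_coe] at hx
    exact lt_irrefl _ hx
  · intro hx
    exact EReal.add_lt_top (EReal.add_lt_top (ne_of_lt hx) (EReal.coe_ne_top _)).ne
      (EReal.coe_ne_top _)

variable {E T : Type*} [NormedAddCommGroup E] [InnerProductSpace ℝ E]
  [NormedAddCommGroup T] [InnerProductSpace ℝ T] [FiniteDimensional ℝ T]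

theorem IsAdmissible.objective_loss_eq {h : T → EReal} (hh : IsAdmissible h) (A : E →ₗ[ℝ] T)
    (c : E) (P : E → ℝ) {x : E} (hx : A x ∈ effDom h) :
    objective (loss h A c) P x = ((realPart h (A x) + inner ℝ c x + P x : ℝ) : EReal) := by
  rw [objective, loss, ← hh.coe_realPart hx, EReal.coe_add, EReal.coe_add]

theorem IsAdmissible.optimalSet_eq {h : T → EReal} (hh : IsAdmissible h) (A : E →ₗ[ℝ] T) (c : E)
    (P : E → ℝ) : optimalSet (objective (loss h A c) P) =
      {x | A x ∈ effDom h ∧ ∀ z, A z ∈ effDom h →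
        realPart h (A x) + inner ℝ c x + P x ≤ realPart h (A z) + inner ℝ c z + P z} := by
  ext x
  rw [optimalSet, Set.mem_ofPred_eq, Set.mem_ofPred_eq, objective_loss_lt_top_iff]
  refine and_congr_right fun hx => ?_
  constructor
  · intro hmin z hz
    have := hmin z
    rwa [hh.objective_loss_eq A c P hx, hh.objective_loss_eq A c P hz, EReal.coe_le_coe_iff] at this
  · intro hmin z
    by_cases hz : A z ∈ effDom h
    · rw [hh.objective_loss_eq A c P hx, hh.objective_loss_eq A c P hz, EReal.coe_le_coe_iff]
      exact hmin z hz
    · rw [← objective_loss_lt_top_iff A c P, not_lt_top_iff] at hz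
      rw [hz]
      exact le_top

theorem IsAdmissible.gradient_loss [FiniteDimensional ℝ E] {h : T → EReal} (hh : IsAdmissible h)
    (A : E →L[ℝ] T) (c : E) {x : E} (hx : A x ∈ effDom h) :
    ∇ (realPart (loss h A.toLinearMap c)) x = A.adjoint (∇ (realPart h) (A x)) + c := by
  refine HasGradientAt.gradient ?_
  have h1 := (hh.hasGradientAt hx).comp_linear_add_inner (A := A) c
  refine h1.congr_of_eventuallyEq ?_
  filter_upwards [(hh.dom_open.preimage A.continuous).mem_nhds hx] with z hz
  have h2 : loss h A.toLinearMap c z = ((realPart h (A z) + inner ℝ c z : ℝ) : EReal) := by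
    rw [EReal.coe_add, hh.coe_realPart hz]
    rfl
  rw [realPart, h2, EReal.toReal_coe]

end Loss

/-- The proximal-map-based error bound for the grouped LASSO. -/
theorem proxErrorBound_groupLasso {T : Type*} [NormedAddCommGroup T] [InnerProductSpace ℝ T]
    [FiniteDimensional ℝ T] (n : ℕ)
    (h : T → EReal) (hh : IsAdmissible h)
    (A : EuclideanSpace ℝ (Fin n) →ₗ[ℝ] T) (c : EuclideanSpace ℝ (Fin n))
    (𝒥 : Finpartition (Finset.univ : Finset (Fin n)))
    (ω : Finset (Fin n) → ℝ) (hω : ∀ J ∈ 𝒥.parts, 0 ≤ ω J)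
    (hne : (optimalSet (objective (loss h A c)
      (groupLasso 𝒥 ω))).Nonempty)
    (hcpt : IsCompact (optimalSet (objective (loss h A c)
      (groupLasso 𝒥 ω)))) :
    ProxErrorBound (loss h A c) (groupLasso 𝒥 ω) := by
  intro ζ _
  have hPconv := convexOn_groupLasso 𝒥 ω hω
  obtain ⟨M, hM0, hM⟩ := exists_groupLasso_lipschitz 𝒥 ω hω
  set A' : EuclideanSpace ℝ (Fin n) →L[ℝ] T := LinearMap.toContinuousLinearMap A
  obtain ⟨κ, hκ, ε, hε, hbound⟩ := exists_infDist_le_mul_norm_residual hh.convexOn_realPart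
    hh.dom_open (fun y hy => hh.hasGradientAt hy) hh.strongConvexOn hh.lipschitzOn_gradient A' c
    hPconv hM0 hM (fun s x₀ hs B => exists_upperLipschitz_groupLasso 𝒥 ω hω A' hs B)
    (hh.optimalSet_eq A c _) hne hcpt
  refine ⟨κ, hκ, ε, hε, fun x hx hR => ?_⟩
  have hxD : A' x ∈ effDom h :=
    (objective_loss_lt_top_iff A c _).1 (hx.trans_lt (EReal.coe_lt_top ζ))
  refine hbound x hxD _ ?_ hR
  have hprox : IsProx (groupLasso 𝒥 ω) (x - ∇ (realPart (loss h A c)) x)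
      (prox (groupLasso 𝒥 ω) (x - ∇ (realPart (loss h A c)) x)) :=
    Classical.epsilon_spec (existsUnique_isProx 𝒥 ω hω _).exists
  have hgrad : ∇ (realPart (loss h A c)) x =
      ContinuousLinearMap.adjoint A' (∇ (realPart h) (A' x)) + c := hh.gradient_loss A' c hxD
  -- With p = x + R, the relation x - ∇f(x) - p ∈ ∂P(p) becomes -∇f(x) - R ∈ ∂P(x + R).
  convert hprox.isSubgradient hPconv using 1
  · rw [GroupLassoEB.residual, ← hgrad]; abel
  · rw [GroupLassoEB.residual]; abel

end GroupLassoEB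

end

theorem mainTheorem7 {T : Type*} [NormedAddCommGroup T] [InnerProductSpace ℝ T]
    [FiniteDimensional ℝ T] (n : ℕ)
    (h : T → EReal) (hh : GroupLassoEB.IsAdmissible h)
    (A : EuclideanSpace ℝ (Fin n) →ₗ[ℝ] T) (c : EuclideanSpace ℝ (Fin n))
    (𝒥 : Finpartition (Finset.univ : Finset (Fin n)))
    (ω : Finset (Fin n) → ℝ) (hω : ∀ J ∈ 𝒥.parts, 0 ≤ ω J)
    (hne : (GroupLassoEB.optimalSet (GroupLassoEB.objective (GroupLassoEB.loss h A c)
      (GroupLassoEB.groupLasso 𝒥 ω))).Nonempty)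
    (hcpt : IsCompact (GroupLassoEB.optimalSet (GroupLassoEB.objective (GroupLassoEB.loss h A c)
      (GroupLassoEB.groupLasso 𝒥 ω)))) :
    GroupLassoEB.ProxErrorBound (GroupLassoEB.loss h A c) (GroupLassoEB.groupLasso 𝒥 ω) :=
  GroupLassoEB.proxErrorBound_groupLasso n h hh A c 𝒥 ω hω hne hcpt
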